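/- Let $F\colon\mathbb R^n\to\mathbb R^m$ be twice continuously differentiable, let $D_1,\ldots,D_r\subset\mathbb R^m$ be polyhedral sets (intersections of finitely many closed half spaces), and put $D:=\bigcup_{i=1}^rD_i$ and $X:=\{x\in\mathbb R^n : F(x)\in D\}$. For sequences of real numbers, $t_k\downarrow 0$ means $t_k>0$ for all $k$ and $t_k\to 0$. For a set $A$ in a Euclidean space and $x\in A$, let $$\mathcal T_A(x):=\{d : \exists\, t_k\downarrow 0,\ \exists\, d_k\to d \text{ with } x+t_kd_k\in A\ \forall k\}$$ be the tangent cone and $\widehat{\mathcal N}_A(x):=\{\eta : \eta\cdot d\le 0\ \ \forall d\in\mathcal T_A(x)\}$ the Fréchet normal cone (both are empty if $x\notin A$). For $d\in\mathcal T_A(x)$, let $$\mathcal T^2_A(x;d):=\{h : \exists\, t_k\downarrow 0,\ \exists\, h_k\to h\text{ with } x+t_kd+\tfrac12t_k^2h_k\in A\ \forall k\},$$ $$\mathcal T^{\flat,2}_A(x;d):=\{h : \forall\, t_k\downarrow 0\ \ \exists\, h_k\to h\text{ with } x+t_kd+\tfrac12t_k^2h_k\in A\ \forall k\}$$ be the outer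 and the inner second-order tangent set; $A$ is called parabolically derivable at $x$ in direction $d$ if $\mathcal T^{\flat,2}_A(x;d)=\mathcal T^{2}_A(x;d)$. Write $\nabla F(x)$ for the Jacobian and $\nabla^2F(x)[d,d]$ for the vector with the components $d^\top\nabla^2F_j(x)d$, $j=1,\ldots,m$. Let $\bar x\in X$ be a point at which MPDC-LICQ holds, that is, with $I(\bar x):=\{i : F(\bar x)\in D_i\}$, $$\nabla F(\bar x)^\top\lambda=0,\quad \lambda\in\sum_{i\in I(\bar x)}\operatorname{span}\widehat{\mathcal N}_{D_i}(F(\bar x))\quad\Longrightarrow\quad\lambda=0.$$ Then, for each $d\in\mathcal T_X(\bar x)$, $$\mathcal T^2_X(\bar x;d)=\bigl\{h\in\mathbb R^n : \nabla F(\bar x)h+\nabla^2F(\bar x)[d,d]\in\mathcal T_{\mathcal T_D(F(\bar x))}(\nabla F(\bar x)d)\bigr\}.$$ Furthermore, $\mathcal T^2_X(\bar x;d)$ is nonempty, and $X$ is parabolically derivable at $\bar x$ in direction $d$. -/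

import Mathlib

open Filter Topology

noncomputable section

namespace MPDC

/-- `t k ↓ 0`: a sequence of positive reals that tends to zero. -/
def DownToZero (t : ℕ → ℝ) : Prop :=
  (∀ k, 0 < t k) ∧ Tendsto t atTop (𝓝 0)

/-- A polyhedral set: an intersection of finitely many closed half spaces. -/
def IsPolyhedral {m : ℕ} (Q : Set (EuclideanSpace ℝ (Fin m))) : Prop :=
  ∃ (N : ℕ) (a : Fin N → EuclideanSpace ℝ (Fin m)) (b : Fin N → ℝ),
    Q = ⋂ j, {y | inner ℝ (a j) y ≤ b j}

/-- The (Bouligand) tangent cone to `A` at `x`; it is empty if `x ∉ A`. -/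
def tangentCone {n : ℕ} (A : Set (EuclideanSpace ℝ (Fin n))) (x : EuclideanSpace ℝ (Fin n)) :
    Set (EuclideanSpace ℝ (Fin n)) :=
  {d | x ∈ A ∧ ∃ (t : ℕ → ℝ) (v : ℕ → EuclideanSpace ℝ (Fin n)),
    DownToZero t ∧ Tendsto v atTop (𝓝 d) ∧ ∀ k, x + t k • v k ∈ A}

/-- The Fréchet (regular) normal cone to `A` at `x`: the polar cone of the tangent cone;
it is empty if `x ∉ A`. -/
def frechetNormalCone {n : ℕ} (A : Set (EuclideanSpace ℝ (Fin n)))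
    (x : EuclideanSpace ℝ (Fin n)) : Set (EuclideanSpace ℝ (Fin n)) :=
  {η | x ∈ A ∧ ∀ d ∈ tangentCone A x, inner ℝ d η ≤ 0}

/-- The outer (Bouligand) second-order tangent set to `A` at `x` in direction `d`;
it is empty if `d` is not tangent to `A` at `x`. -/
def outerTangentSet₂ {n : ℕ} (A : Set (EuclideanSpace ℝ (Fin n)))
    (x d : EuclideanSpace ℝ (Fin n)) : Set (EuclideanSpace ℝ (Fin n)) :=
  {h | d ∈ tangentCone A x ∧ ∃ (t : ℕ → ℝ) (v : ℕ → EuclideanSpace ℝ (Fin n)),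
    DownToZero t ∧ Tendsto v atTop (𝓝 h) ∧
      ∀ k, x + t k • d + ((1 / 2 : ℝ) * t k ^ 2) • v k ∈ A}

/-- The inner (adjacent) second-order tangent set to `A` at `x` in direction `d`;
it is empty if `d` is not tangent to `A` at `x`. -/
def innerTangentSet₂ {n : ℕ} (A : Set (EuclideanSpace ℝ (Fin n)))
    (x d : EuclideanSpace ℝ (Fin n)) : Set (EuclideanSpace ℝ (Fin n)) :=
  {h | d ∈ tangentCone A x ∧ ∀ t : ℕ → ℝ, DownToZero t →
    ∃ v : ℕ → EuclideanSpace ℝ (Fin n), Tendsto v atTop (𝓝 h) ∧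
      ∀ k, x + t k • d + ((1 / 2 : ℝ) * t k ^ 2) • v k ∈ A}

/-- `A` is parabolically derivable at `x` in direction `d`. -/
def ParabolicallyDerivableAt {n : ℕ} (A : Set (EuclideanSpace ℝ (Fin n)))
    (x d : EuclideanSpace ℝ (Fin n)) : Prop :=
  innerTangentSet₂ A x d = outerTangentSet₂ A x d

/-- `∇²P(x)[d,h]`, the second derivative of `P` at `x` as a vector-valued bilinear form.
For a twice continuously differentiable `P` its `i`-th component is `dᵀ ∇²Pᵢ(x) h`. -/
def secondDeriv {n m : ℕ} (P : EuclideanSpace ℝ (Fin n) → EuclideanSpace ℝ (Fin m))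
    (x d h : EuclideanSpace ℝ (Fin n)) : EuclideanSpace ℝ (Fin m) :=
  fderiv ℝ (fderiv ℝ P) x d h

/-- The union `D = D₁ ∪ … ∪ D_r`. -/
def disjunctiveSet {m r : ℕ} (D : Fin r → Set (EuclideanSpace ℝ (Fin m))) :
    Set (EuclideanSpace ℝ (Fin m)) :=
  ⋃ i, D i

/-- The feasible set `X = {x | F(x) ∈ D₁ ∪ … ∪ D_r}`. -/
def feasibleSet {n m r : ℕ} (F : EuclideanSpace ℝ (Fin n) → EuclideanSpace ℝ (Fin m))
    (D : Fin r → Set (EuclideanSpace ℝ (Fin m))) : Set (EuclideanSpace ℝ (Fin n)) :=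
  {x | F x ∈ disjunctiveSet D}

/-- MPDC-LICQ at `x`: the only `lam` in the sum of the spans of the Fréchet normal cones to
those `D i` that contain `F x`, with `∇F(x)ᵀ lam = 0`, is `lam = 0`. -/
def LICQ {n m r : ℕ} (F : EuclideanSpace ℝ (Fin n) → EuclideanSpace ℝ (Fin m))
    (D : Fin r → Set (EuclideanSpace ℝ (Fin m))) (x : EuclideanSpace ℝ (Fin n)) : Prop :=
  ∀ lam : EuclideanSpace ℝ (Fin m),
    ContinuousLinearMap.adjoint (fderiv ℝ F x) lam = 0 →
    lam ∈ (⨆ (i : Fin r) (_ : F x ∈ D i), Submodule.span ℝ (frechetNormalCone (D i) (F x))) →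
    lam = 0

end MPDC

end

/-!
The chain rule reduces the second-order tangents of `X = F ⁻¹' D` to those of `D`: expanding `F` to
second order along a parabola `x + t d + ½ t² h` shows that `h` is tangent to `X` only if
`∇F h + ∇²F[d, d]` is a second-order tangent to `D`, and metric subregularity of the constraint
`F(·) ∈ D` corrects a parabola that misses `X` by `o(t²)`, which gives the converse.
A finite union of polyhedra coincides with its tangent cone near each point, and so does that
tangent cone. Hence `F x + t v + ½ t² w` lies in `D` for small `t > 0` iff `v + ½ t w` lies in
`T_D(F x)`, so that both kinds of second-order tangent set of `D` equal `T_{T_D(F x)}(v)`.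

LICQ enters through the subspace `S` spanned by the normals: near `F x`, the set `D` is invariant
under translations along `Sᗮ`, so feasibility only depends on the projection of `F` to `S`.
By LICQ this projection is a submersion, and the Lyusternik–Graves theorem gives subregularity.
-/

open scoped NNReal

namespace MPDC

section Sequences

variable {E : Type*} {t : ℕ → ℝ}

theorem DownToZero.comp_strictMono (ht : DownToZero t) {φ : ℕ → ℕ} (hφ : StrictMono φ) :
    DownToZero (t ∘ φ) :=
  ⟨fun k => ht.1 (φ k), ht.2.comp hφ.tendsto_atTop⟩

theorem DownToZero.div_const (ht : DownToZero t) {c : ℝ} (hc : 0 < c) :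
    DownToZero fun k => t k / c :=
  ⟨fun k => div_pos (ht.1 k) hc, by simpa using ht.2.div_const c⟩

theorem downToZero_one_div_add_one : DownToZero fun k : ℕ => 1 / ((k : ℝ) + 1) :=
  ⟨fun k => by positivity, tendsto_one_div_add_atTop_nhds_zero_nat⟩

theorem DownToZero.tendsto_parabola [NormedAddCommGroup E] [NormedSpace ℝ E] (ht : DownToZero t)
    (x d : E) {v : ℕ → E} {h : E} (hv : Tendsto v atTop (𝓝 h)) :
    Tendsto (fun k => x + t k • d + ((1 / 2 : ℝ) * t k ^ 2) • v k) atTop (𝓝 x) := by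
  simpa only [zero_pow two_ne_zero, mul_zero, zero_smul, add_zero] using
    ((ht.2.smul_const d).const_add x).add (((ht.2.pow 2).const_mul (1 / 2)).smul hv)

end Sequences

section SecondOrderQuotient

variable {E : Type*} [AddCommGroup E] [Module ℝ E] {t : ℝ}

/-- The second-order difference quotient at `x` in direction `d`: it assigns to `z` the vector `h`
with `z = x + t d + ½ t² h`. -/
noncomputable def secondOrderQuotient (x d : E) (t : ℝ) (z : E) : E := (2 / t ^ 2) • (z - x - t • d)

theorem parabola_secondOrderQuotient (ht : t ≠ 0) (x d z : E) :
    x + t • d + ((1 / 2 : ℝ) * t ^ 2) • secondOrderQuotient x d t z = z := by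
  unfold secondOrderQuotient
  match_scalars <;> field_simp <;> ring

theorem secondOrderQuotient_parabola (ht : t ≠ 0) (x d h : E) :
    secondOrderQuotient x d t (x + t • d + ((1 / 2 : ℝ) * t ^ 2) • h) = h := by
  unfold secondOrderQuotient
  match_scalars <;> field_simp <;> ring

theorem secondOrderQuotient_sub (x d z z' : E) :
    secondOrderQuotient x d t z - secondOrderQuotient x d t z' = (2 / t ^ 2) • (z - z') := by
  unfold secondOrderQuotient
  rw [← smul_sub]
  congr 1
  abel

end SecondOrderQuotient

section TangentSets

variable {n : ℕ} {A C : Set (EuclideanSpace ℝ (Fin n))} {x d h : EuclideanSpace ℝ (Fin n)}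

theorem mem_tangentCone_of_frequently (hx : x ∈ A) {t : ℕ → ℝ} (ht : DownToZero t)
    {v : ℕ → EuclideanSpace ℝ (Fin n)} (hv : Tendsto v atTop (𝓝 d))
    (hA : ∃ᶠ k in atTop, x + t k • v k ∈ A) : d ∈ tangentCone A x := by
  obtain ⟨φ, hφ, hφA⟩ := extraction_of_frequently_atTop hA
  exact ⟨hx, t ∘ φ, v ∘ φ, ht.comp_strictMono hφ, hv.comp hφ.tendsto_atTop, hφA⟩

theorem smul_mem_tangentCone (hd : d ∈ tangentCone A x) {c : ℝ} (hc : 0 < c) :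
    c • d ∈ tangentCone A x := by
  obtain ⟨hx, t, v, ht, hv, hA⟩ := hd
  refine ⟨hx, fun k => t k / c, fun k => c • v k, ht.div_const hc, hv.const_smul c, fun k => ?_⟩
  rw [smul_smul, div_mul_cancel₀ _ hc.ne']
  exact hA k

theorem tangentCone_eq_of_eventually_mem_iff (hx : x ∈ A) (hC : IsClosed C)
    (hcone : ∀ c : ℝ, 0 < c → ∀ z ∈ C, c • z ∈ C)
    (hAC : ∀ᶠ z in 𝓝 (0 : EuclideanSpace ℝ (Fin n)), x + z ∈ A ↔ z ∈ C) :
    tangentCone A x = C := by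
  ext d
  constructor
  · rintro ⟨-, t, v, ht, hv, hA⟩
    have htv : Tendsto (fun k => t k • v k) atTop (𝓝 0) := by simpa using ht.2.smul hv
    refine hC.mem_of_tendsto hv ((htv.eventually hAC).mono fun k hk => ?_)
    simpa [smul_smul, (ht.1 k).ne'] using hcone (t k)⁻¹ (inv_pos.2 (ht.1 k)) _ (hk.1 (hA k))
  · intro hd
    have ht := downToZero_one_div_add_one
    have htd : Tendsto (fun k : ℕ => (1 / ((k : ℝ) + 1)) • d) atTop (𝓝 0) := by
      simpa using ht.2.smul_const d
    exact mem_tangentCone_of_frequently hx ht tendsto_const_nhds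
      ((htd.eventually hAC).mono fun k hk => hk.2 (hcone _ (ht.1 k) d hd)).frequently

theorem tangentCone_mono {B : Set (EuclideanSpace ℝ (Fin n))} (hAB : A ⊆ B) :
    tangentCone A x ⊆ tangentCone B x :=
  fun _ ⟨hx, t, v, ht, hv, hA⟩ => ⟨hAB hx, t, v, ht, hv, fun k => hAB (hA k)⟩

theorem tangentCone_iUnion {ι : Type*} [Finite ι] {D : ι → Set (EuclideanSpace ℝ (Fin n))}
    (hD : ∀ i, IsClosed (D i)) (x : EuclideanSpace ℝ (Fin n)) :
    tangentCone (⋃ i, D i) x = ⋃ i, tangentCone (D i) x := by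
  refine Set.Subset.antisymm (fun d hd => ?_)
    (Set.iUnion_subset fun i => tangentCone_mono (Set.subset_iUnion D i))
  obtain ⟨-, t, v, ht, hv, hmem⟩ := hd
  obtain ⟨i, hi⟩ : ∃ i, ∃ᶠ k in atTop, x + t k • v k ∈ D i :=
    frequently_exists.1 (Frequently.of_forall fun k => Set.mem_iUnion.1 (hmem k))
  have hlim : Tendsto (fun k => x + t k • v k) atTop (𝓝 x) := by
    simpa using (ht.2.smul hv).const_add x
  exact Set.mem_iUnion.2
    ⟨i, mem_tangentCone_of_frequently ((hD i).mem_of_frequently_of_tendsto hi hlim) ht hv hi⟩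

theorem mem_innerTangentSet₂_of_eventually (hd : d ∈ tangentCone A x)
    (hA : ∀ t : ℕ → ℝ, DownToZero t → ∃ v : ℕ → EuclideanSpace ℝ (Fin n),
      Tendsto v atTop (𝓝 h) ∧ ∀ᶠ k in atTop, x + t k • d + ((1 / 2 : ℝ) * t k ^ 2) • v k ∈ A) :
    h ∈ innerTangentSet₂ A x d := by
  classical
  refine ⟨hd, fun t ht => ?_⟩
  obtain ⟨v, hv, hvA⟩ := hA t ht
  refine ⟨fun k => if x + t k • d + ((1 / 2 : ℝ) * t k ^ 2) • v k ∈ A then v k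
    else secondOrderQuotient x d (t k) x, hv.congr' (hvA.mono fun k hk => (if_pos hk).symm),
    fun k => ?_⟩
  dsimp only
  split_ifs with hk
  · exact hk
  · rw [parabola_secondOrderQuotient (ht.1 k).ne']
    exact hd.1

theorem innerTangentSet₂_subset_outerTangentSet₂ (A : Set (EuclideanSpace ℝ (Fin n)))
    (x d : EuclideanSpace ℝ (Fin n)) : innerTangentSet₂ A x d ⊆ outerTangentSet₂ A x d := by
  rintro h ⟨hd, hA⟩
  obtain ⟨v, hv, hvA⟩ := hA _ downToZero_one_div_add_one
  exact ⟨hd, _, v, downToZero_one_div_add_one, hv, hvA⟩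

end TangentSets

section LocallyConic

variable {n : ℕ} {A : Set (EuclideanSpace ℝ (Fin n))} {x d : EuclideanSpace ℝ (Fin n)}

/-- `A` coincides near `x` with the translate `x + T_A(x)` of its tangent cone. -/
def LocallyConicAt (A : Set (EuclideanSpace ℝ (Fin n))) (x : EuclideanSpace ℝ (Fin n)) : Prop :=
  ∀ᶠ z in 𝓝 0, x + z ∈ A ↔ z ∈ tangentCone A x

theorem LocallyConicAt.outerTangentSet₂_subset (hA : LocallyConicAt A x) :
    outerTangentSet₂ A x d ⊆ tangentCone (tangentCone A x) d := by
  rintro h ⟨hd, t, v, ht, hv, hvA⟩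
  have hlim : Tendsto (fun k => t k • d + ((1 / 2 : ℝ) * t k ^ 2) • v k) atTop (𝓝 0) := by
    simpa using ht.tendsto_parabola 0 d hv
  refine mem_tangentCone_of_frequently hd (ht.div_const two_pos) hv
    (Eventually.frequently ((hlim.eventually hA).mono fun k hk => ?_))
  have hT := hk.1 (by simpa only [add_assoc] using hvA k)
  convert smul_mem_tangentCone hT (inv_pos.2 (ht.1 k)) using 1
  have := (ht.1 k).ne'
  match_scalars <;> field_simp

theorem LocallyConicAt.tangentCone_subset_innerTangentSet₂ (hA : LocallyConicAt A x)
    (hT : LocallyConicAt (tangentCone A x) d) :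
    tangentCone (tangentCone A x) d ⊆ innerTangentSet₂ A x d := by
  intro h hh
  refine mem_innerTangentSet₂_of_eventually hh.1 fun t ht => ⟨fun _ => h, tendsto_const_nhds, ?_⟩
  have hlim : Tendsto (fun k => t k • d + ((1 / 2 : ℝ) * t k ^ 2) • h) atTop (𝓝 0) := by
    simpa using ht.tendsto_parabola 0 d (tendsto_const_nhds (x := h))
  have hlim' : Tendsto (fun k => (t k / 2) • h) atTop (𝓝 0) := by
    simpa using (ht.div_const two_pos).2.smul_const h
  filter_upwards [hlim.eventually hA, hlim'.eventually hT] with k hkA hkT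
  have hTk : d + (t k / 2) • h ∈ tangentCone A x :=
    hkT.2 (smul_mem_tangentCone hh (half_pos (ht.1 k)))
  rw [add_assoc]
  refine hkA.2 ?_
  convert smul_mem_tangentCone hTk (ht.1 k) using 1
  match_scalars <;> ring

end LocallyConic

section Polyhedra

section LinearizedCone

variable {E ι : Type*} [NormedAddCommGroup E] [InnerProductSpace ℝ E]

/-- The cone cut out by the linear parts of those constraints `⟪a j, ·⟫ ≤ b j` that are active
at `y`. -/
def linearizedCone (a : ι → E) (b : ι → ℝ) (y : E) : Set E :=
  {z | ∀ j, inner ℝ (a j) y = b j → inner ℝ (a j) z ≤ 0}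

theorem isClosed_linearizedCone (a : ι → E) (b : ι → ℝ) (y : E) :
    IsClosed (linearizedCone a b y) := by
  simp only [linearizedCone, Set.ofPred_forall]
  exact isClosed_iInter fun j => isClosed_iInter fun _ =>
    isClosed_le (by fun_prop) continuous_const

theorem smul_mem_linearizedCone {a : ι → E} {b : ι → ℝ} {y z : E} (hz : z ∈ linearizedCone a b y)
    {c : ℝ} (hc : 0 ≤ c) : c • z ∈ linearizedCone a b y := fun j hj => by
  rw [inner_smul_right]
  exact mul_nonpos_of_nonneg_of_nonpos hc (hz j hj)

theorem eventually_add_mem_iff_mem_linearizedCone [Finite ι] {a : ι → E} {b : ι → ℝ} {y : E}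
    (hy : y ∈ ⋂ j, {z | inner ℝ (a j) z ≤ b j}) :
    ∀ᶠ z in 𝓝 0, y + z ∈ ⋂ j, {z | inner ℝ (a j) z ≤ b j} ↔ z ∈ linearizedCone a b y := by
  have hinactive : ∀ᶠ z in 𝓝 (0 : E), ∀ j,
      inner ℝ (a j) y ≠ b j → inner ℝ (a j) (y + z) < b j := by
    refine eventually_all.2 fun j => eventually_imp_distrib_left.2 fun hj => ?_
    have hlt : inner ℝ (a j) (y + 0) < b j := by
      simpa using lt_of_le_of_ne (Set.mem_iInter.1 hy j) hj
    exact ContinuousAt.eventually_lt (by fun_prop) continuousAt_const hlt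
  filter_upwards [hinactive] with z hz
  rw [Set.mem_iInter]
  refine forall_congr' fun j => ?_
  by_cases hj : inner ℝ (a j) y = b j
  · simp [inner_add_right, hj]
  · simp [hj, (hz j hj).le]

end LinearizedCone

variable {m r : ℕ} {Q : Set (EuclideanSpace ℝ (Fin m))}
  {D : Fin r → Set (EuclideanSpace ℝ (Fin m))} {y z l : EuclideanSpace ℝ (Fin m)}

theorem IsPolyhedral.isClosed (hQ : IsPolyhedral Q) : IsClosed Q := by
  obtain ⟨N, a, b, rfl⟩ := hQ
  exact isClosed_iInter fun j => isClosed_le (by fun_prop) continuous_const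

theorem isPolyhedral_empty : IsPolyhedral (∅ : Set (EuclideanSpace ℝ (Fin m))) :=
  ⟨1, fun _ => 0, fun _ => -1, by ext; simp⟩

theorem isPolyhedral_linearizedCone {N : ℕ} (a : Fin N → EuclideanSpace ℝ (Fin m)) (b : Fin N → ℝ)
    (y : EuclideanSpace ℝ (Fin m)) : IsPolyhedral (linearizedCone a b y) := by
  classical
  refine ⟨N, fun j => if inner ℝ (a j) y = b j then a j else 0, fun _ => 0, ?_⟩
  ext z
  simp only [linearizedCone, Set.mem_iInter, Set.mem_ofPred_eq]
  refine forall_congr' fun j => ?_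
  split_ifs with hj <;> simp [hj]

theorem tangentCone_polyhedron {ι : Type*} [Finite ι] {a : ι → EuclideanSpace ℝ (Fin m)}
    {b : ι → ℝ} (hy : y ∈ ⋂ j, {z | inner ℝ (a j) z ≤ b j}) :
    tangentCone (⋂ j, {z | inner ℝ (a j) z ≤ b j}) y = linearizedCone a b y :=
  tangentCone_eq_of_eventually_mem_iff hy (isClosed_linearizedCone a b y)
    (fun _ hc _ hz => smul_mem_linearizedCone hz hc.le)
    (eventually_add_mem_iff_mem_linearizedCone hy)

theorem tangentCone_eq_empty (hy : y ∉ Q) : tangentCone Q y = ∅ :=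
  Set.eq_empty_of_forall_notMem fun _ hd => hy hd.1

theorem IsPolyhedral.tangentCone (hQ : IsPolyhedral Q) (y : EuclideanSpace ℝ (Fin m)) :
    IsPolyhedral (tangentCone Q y) := by
  by_cases hy : y ∈ Q
  · obtain ⟨N, a, b, rfl⟩ := hQ
    rw [tangentCone_polyhedron hy]
    exact isPolyhedral_linearizedCone a b y
  · rw [tangentCone_eq_empty hy]
    exact isPolyhedral_empty

theorem IsPolyhedral.locallyConicAt (hQ : IsPolyhedral Q) (y : EuclideanSpace ℝ (Fin m)) :
    LocallyConicAt Q y := by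
  by_cases hy : y ∈ Q
  · obtain ⟨N, a, b, rfl⟩ := hQ
    rw [LocallyConicAt, tangentCone_polyhedron hy]
    exact eventually_add_mem_iff_mem_linearizedCone hy
  · have hlim : Tendsto (fun z => y + z) (𝓝 0) (𝓝 y) := by
      simpa using (continuous_const_add y).tendsto 0
    filter_upwards [hlim.eventually (hQ.isClosed.isOpen_compl.mem_nhds hy)] with z hz
    exact iff_of_false hz fun hT => hy hT.1

theorem mem_frechetNormalCone_of_isMaxOn (hy : y ∈ Q) (hl : IsMaxOn (fun z => inner ℝ l z) Q y) :
    l ∈ frechetNormalCone Q y := by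
  refine ⟨hy, ?_⟩
  rintro d ⟨-, t, v, ht, hv, hQ⟩
  refine le_of_tendsto' (hv.inner tendsto_const_nhds) fun k => ?_
  have hle : inner ℝ l (y + t k • v k) ≤ inner ℝ l y := hl (hQ k)
  rw [inner_add_right, inner_smul_right, add_le_iff_nonpos_right, real_inner_comm] at hle
  exact nonpos_of_mul_nonpos_right hle (ht.1 k)

theorem IsPolyhedral.add_mem_tangentCone (hQ : IsPolyhedral Q) (hz : z ∈ MPDC.tangentCone Q y)
    (hl : ∀ a ∈ frechetNormalCone Q y, inner ℝ a l = 0) : z + l ∈ MPDC.tangentCone Q y := by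
  have hy := hz.1
  obtain ⟨N, a, b, rfl⟩ := hQ
  rw [tangentCone_polyhedron hy] at hz ⊢
  intro j hj
  have hnormal : a j ∈ frechetNormalCone (⋂ j, {z | inner ℝ (a j) z ≤ b j}) y :=
    mem_frechetNormalCone_of_isMaxOn hy fun w hw => (Set.mem_iInter.1 hw j).trans_eq hj.symm
  rw [inner_add_right, hl _ hnormal, add_zero]
  exact hz j hj

theorem tangentCone_disjunctiveSet (hD : ∀ i, IsPolyhedral (D i))
    (y : EuclideanSpace ℝ (Fin m)) :
    tangentCone (disjunctiveSet D) y = disjunctiveSet fun i => tangentCone (D i) y :=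
  tangentCone_iUnion (fun i => (hD i).isClosed) y

theorem locallyConicAt_disjunctiveSet (hD : ∀ i, IsPolyhedral (D i))
    (y : EuclideanSpace ℝ (Fin m)) : LocallyConicAt (disjunctiveSet D) y := by
  rw [LocallyConicAt, tangentCone_disjunctiveSet hD]
  filter_upwards [eventually_all.2 fun i => (hD i).locallyConicAt y] with z hz
  simp only [disjunctiveSet, Set.mem_iUnion, hz]

theorem locallyConicAt_tangentCone_disjunctiveSet (hD : ∀ i, IsPolyhedral (D i))
    (y v : EuclideanSpace ℝ (Fin m)) : LocallyConicAt (tangentCone (disjunctiveSet D) y) v := by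
  rw [tangentCone_disjunctiveSet hD]
  exact locallyConicAt_disjunctiveSet (fun i => (hD i).tangentCone y) v

/-- The sum of the spans of the Fréchet normal cones at `y` to those `D i` that contain `y`, the
subspace of multipliers in MPDC-LICQ. -/
def normalSpan (D : Fin r → Set (EuclideanSpace ℝ (Fin m))) (y : EuclideanSpace ℝ (Fin m)) :
    Submodule ℝ (EuclideanSpace ℝ (Fin m)) :=
  ⨆ (i : Fin r) (_ : y ∈ D i), Submodule.span ℝ (frechetNormalCone (D i) y)

theorem frechetNormalCone_subset_normalSpan (i : Fin r) :
    frechetNormalCone (D i) y ⊆ normalSpan D y := fun _ ha =>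
  Submodule.mem_iSup_of_mem i (Submodule.mem_iSup_of_mem ha.1 (Submodule.subset_span ha))

theorem add_mem_tangentCone_disjunctiveSet (hD : ∀ i, IsPolyhedral (D i))
    (hz : z ∈ tangentCone (disjunctiveSet D) y) (hl : l ∈ (normalSpan D y)ᗮ) :
    z + l ∈ tangentCone (disjunctiveSet D) y := by
  rw [tangentCone_disjunctiveSet hD] at hz ⊢
  obtain ⟨i, hi⟩ := Set.mem_iUnion.1 hz
  exact Set.mem_iUnion.2
    ⟨i, (hD i).add_mem_tangentCone hi fun a ha => hl a (frechetNormalCone_subset_normalSpan i ha)⟩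

theorem orthogonal_normalSpan_subset_tangentCone_tangentCone (hD : ∀ i, IsPolyhedral (D i))
    (hz : z ∈ tangentCone (disjunctiveSet D) y) :
    ((normalSpan D y)ᗮ : Set (EuclideanSpace ℝ (Fin m))) ⊆
      tangentCone (tangentCone (disjunctiveSet D) y) z := fun l hl =>
  ⟨hz, _, fun _ => l, downToZero_one_div_add_one, tendsto_const_nhds, fun _ =>
    add_mem_tangentCone_disjunctiveSet hD hz (Submodule.smul_mem _ _ hl)⟩

theorem eventually_mem_disjunctiveSet_of_sub_mem_orthogonal (hD : ∀ i, IsPolyhedral (D i))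
    (y : EuclideanSpace ℝ (Fin m)) :
    ∀ᶠ p in 𝓝 (y, y), p.1 ∈ disjunctiveSet D → p.2 - p.1 ∈ (normalSpan D y)ᗮ →
      p.2 ∈ disjunctiveSet D := by
  have hsub : Tendsto (fun z => z - y) (𝓝 y) (𝓝 0) := by
    simpa using (continuous_sub_right y).tendsto y
  have hconic := hsub.eventually (locallyConicAt_disjunctiveSet hD y)
  simp only [add_sub_cancel] at hconic
  rw [nhds_prod_eq]
  filter_upwards [hconic.prod_inl _, hconic.prod_inr _] with p h₁ h₂ hp hl
  rw [h₂, ← sub_add_sub_cancel' p.1 y p.2]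
  exact add_mem_tangentCone_disjunctiveSet hD (h₁.1 hp) hl

end Polyhedra

section Taylor

variable {E G : Type*} [NormedAddCommGroup E] [NormedSpace ℝ E] [NormedAddCommGroup G]
  [NormedSpace ℝ G] {F : E → G} {x : E}

theorem isLittleO_taylor_two (hF : ContDiffAt ℝ 2 F x) :
    (fun y => F y - F x - fderiv ℝ F x (y - x)
      - (1 / 2 : ℝ) • fderiv ℝ (fderiv ℝ F) x (y - x) (y - x)) =o[𝓝 x] fun y => ‖y - x‖ ^ 2 := by
  set A := fderiv ℝ F x
  set H := fderiv ℝ (fderiv ℝ F) x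
  have hsymm : IsSymmSndFDerivAt ℝ F x := hF.isSymmSndFDerivAt (by simp)
  have hdiff : ∀ᶠ y in 𝓝 x, DifferentiableAt ℝ F y :=
    (hF.eventually (by simp)).mono fun y hy => hy.differentiableAt (by norm_num)
  obtain ⟨δ, hδ, hball⟩ := Metric.eventually_nhds_iff_ball.1 hdiff
  have hderiv : ∀ y ∈ Metric.ball x δ, HasFDerivWithinAt
      (fun y => F y - A (y - x) - (1 / 2 : ℝ) • H (y - x) (y - x))
      (fderiv ℝ F y - A - H (y - x)) (Metric.ball x δ) y := by
    intro y hy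
    have hid : HasFDerivAt (fun y : E => y - x) (ContinuousLinearMap.id ℝ E) y :=
      (hasFDerivAt_id y).sub_const x
    have hquad := ((H.hasFDerivAt.comp y hid).clm_apply hid).const_smul (1 / 2 : ℝ)
    refine (((hball y hy).hasFDerivAt.sub (A.hasFDerivAt.comp y hid)).sub
      hquad).hasFDerivWithinAt.congr_fderiv ?_
    ext u
    have hu : H u (y - x) = H (y - x) u := hsymm u (y - x)
    simp only [sub_apply, add_apply, smul_apply, ContinuousLinearMap.comp_apply,
      ContinuousLinearMap.flip_apply, ContinuousLinearMap.id_apply, Function.comp_apply, hu]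
    match_scalars <;> norm_num
  have hsmall : (fun y => fderiv ℝ F y - A - H (y - x)) =o[𝓝 x] fun y => ‖y - x‖ ^ 1 := by
    simpa using ((hF.fderiv_right (m := 1) (by norm_num)).differentiableAt
      (by norm_num)).hasFDerivAt.isLittleO.norm_right
  have hx := Metric.mem_ball_self (x := x) hδ
  have hmain := (convex_ball x δ).isLittleO_pow_succ hx hderiv (hsmall.mono nhdsWithin_le_nhds)
  rw [Metric.isOpen_ball.nhdsWithin_eq hx] at hmain
  refine hmain.congr_left fun y => ?_
  simp only [sub_self, map_zero, smul_zero, sub_zero]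
  abel

theorem tendsto_secondOrderQuotient_comp (hF : ContDiffAt ℝ 2 F x) (d : E) {h : E} {t : ℕ → ℝ}
    (ht : DownToZero t) {v : ℕ → E} (hv : Tendsto v atTop (𝓝 h)) :
    Tendsto (fun k => secondOrderQuotient (F x) (fderiv ℝ F x d) (t k)
      (F (x + t k • d + ((1 / 2 : ℝ) * t k ^ 2) • v k))) atTop
      (𝓝 (fderiv ℝ F x h + fderiv ℝ (fderiv ℝ F) x d d)) := by
  set A := fderiv ℝ F x
  set H := fderiv ℝ (fderiv ℝ F) x
  set u : ℕ → E := fun k => d + (t k / 2) • v k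
  have hu : Tendsto u atTop (𝓝 d) := by
    simpa using ((ht.div_const two_pos).2.smul hv).const_add d
  have hp : ∀ k, x + t k • d + ((1 / 2 : ℝ) * t k ^ 2) • v k = x + t k • u k := fun k => by
    simp only [u]
    match_scalars <;> ring
  have hlim : Tendsto (fun k => x + t k • u k) atTop (𝓝 x) := by
    simpa using (ht.2.smul hu).const_add x
  have hO : (fun k => ‖t k • u k‖ ^ 2) =O[atTop] fun k => t k ^ 2 := by
    simpa using (((Asymptotics.isBigO_refl t atTop).smul (hu.isBigO_one ℝ)).norm_left.pow 2)
  have hrest : (fun k => F (x + t k • u k) - F x - A (t k • u k)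
      - (1 / 2 : ℝ) • H (t k • u k) (t k • u k)) =o[atTop] fun k => ‖t k • u k‖ ^ 2 := by
    simpa only [Function.comp_def, add_sub_cancel_left] using
      (isLittleO_taylor_two hF).comp_tendsto hlim
  have hquad : Tendsto (fun k => H (u k) (u k)) atTop (𝓝 (H d d)) :=
    ((by fun_prop : Continuous fun w => H w w).tendsto d).comp hu
  have hsum := ((hrest.trans_isBigO hO).tendsto_inv_smul_nhds_zero.const_smul (2 : ℝ)).add
    (((A.continuous.tendsto h).comp hv).add hquad)
  rw [smul_zero, zero_add] at hsum
  refine hsum.congr fun k => ?_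
  have hAu : A (u k) = A d + (t k / 2) • A (v k) := by rw [map_add, map_smul]
  have := (ht.1 k).ne'
  simp only [secondOrderQuotient, hp, hAu, Function.comp_apply, map_smul, smul_apply]
  match_scalars <;> field_simp <;> ring

end Taylor

section MetricSubregularity

variable {E G H : Type*} [NormedAddCommGroup E] [NormedAddCommGroup G] [NormedAddCommGroup H]

/-- Metric subregularity at `x` of the constraint `F p ∈ A`: up to a constant factor, the distance
of `p` from the feasible set is at most the distance of `F p` from `A`. The estimate is stated for
points of `A` close to `F x` instead of distances, so that nearest points need not exist. -/
def MetricallySubregularAt (F : E → G) (A : Set G) (x : E) : Prop :=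
  ∃ c : ℝ≥0, ∀ᶠ p in 𝓝 (x, F x), p.2 ∈ A → ∃ q ∈ F ⁻¹' A, ‖q - p.1‖ ≤ c * ‖F p.1 - p.2‖

theorem eventually_dist_add_mul_norm_lt {F : E → G} {x : E} (hF : ContinuousAt F x) (c : ℝ)
    {ρ : ℝ} (hρ : 0 < ρ) : ∀ᶠ p in 𝓝 (x, F x), c * ‖F p.1 - p.2‖ + dist p.1 x < ρ := by
  have : ContinuousAt (fun p : E × G => F p.1) (x, F x) := hF.comp continuousAt_fst
  have hcont : ContinuousAt (fun p : E × G => c * ‖F p.1 - p.2‖ + dist p.1 x) (x, F x) := by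
    fun_prop
  exact hcont.eventually_lt continuousAt_const (by simpa using hρ)

variable [NormedSpace ℝ E] [NormedSpace ℝ G] [NormedSpace ℝ H] [CompleteSpace E]

/-- The Lyusternik–Graves theorem. -/
theorem exists_eq_norm_sub_le_of_range_eq_top [CompleteSpace H] {f : E → H} {f' : E →L[ℝ] H}
    {x : E} (hf : HasStrictFDerivAt f f' x) (hsurj : f'.range = ⊤) :
    ∃ c : ℝ≥0, ∀ᶠ p in 𝓝 (x, f x), ∃ q, f q = p.2 ∧ ‖q - p.1‖ ≤ c * ‖f p.1 - p.2‖ := by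
  let R := f'.nonlinearRightInverseOfSurjective hsurj
  have hR : 0 < R.nnnorm := f'.nonlinearRightInverseOfSurjective_nnnorm_pos hsurj
  obtain ⟨s, hs, happrox⟩ :=
    hf.approximates_deriv_on_nhds (c := R.nnnorm⁻¹ / 2) (Or.inr (by positivity))
  obtain ⟨ρ, hρ, hball⟩ := Metric.mem_nhds_iff.1 hs
  refine ⟨2 * R.nnnorm, ?_⟩
  filter_upwards [eventually_dist_add_mul_norm_lt hf.continuousAt (2 * R.nnnorm : ℝ≥0) hρ]
    with p hp
  have hsub : Metric.closedBall p.1 ((2 * R.nnnorm : ℝ≥0) * ‖f p.1 - p.2‖) ⊆ s :=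
    (Metric.closedBall_subset_ball' hp).trans hball
  have hradius : ((R.nnnorm : ℝ)⁻¹ - (R.nnnorm⁻¹ / 2 : ℝ≥0)) *
      ((2 * R.nnnorm : ℝ≥0) * ‖f p.1 - p.2‖) = ‖f p.1 - p.2‖ := by
    have : (R.nnnorm : ℝ) ≠ 0 := mod_cast hR.ne'
    push_cast
    field_simp
    ring
  have hmem : p.2 ∈ Metric.closedBall (f p.1) (((R.nnnorm : ℝ)⁻¹ - (R.nnnorm⁻¹ / 2 : ℝ≥0)) *
      ((2 * R.nnnorm : ℝ≥0) * ‖f p.1 - p.2‖)) := by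
    rw [hradius, mem_closedBall_iff_norm']
  obtain ⟨q, hq, hfq⟩ := happrox.surjOn_closedBall_of_nonlinearRightInverse R (by positivity)
    hsub hmem
  exact ⟨q, hfq, mem_closedBall_iff_norm.1 hq⟩

theorem metricallySubregularAt_of_range_comp_eq_top [CompleteSpace H] {F : E → G} {F' : E →L[ℝ] G}
    {x : E} (hF : HasStrictFDerivAt F F' x) (P : G →L[ℝ] H) (hsurj : (P ∘L F').range = ⊤)
    {A : Set G} (hA : ∀ᶠ p in 𝓝 (F x, F x), p.1 ∈ A → P p.2 = P p.1 → p.2 ∈ A) :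
    MetricallySubregularAt F A x := by
  obtain ⟨c, hc⟩ := exists_eq_norm_sub_le_of_range_eq_top (P.hasStrictFDerivAt.comp x hF) hsurj
  have hFA : ∀ᶠ p in 𝓝 (x, F x), p.2 ∈ A → P (F p.1) = P p.2 → F p.1 ∈ A :=
    ((continuousAt_snd (p := (x, F x))).prodMk
      (hF.continuousAt.comp continuousAt_fst)).eventually hA
  obtain ⟨ρ, hρ, hball⟩ := Metric.eventually_nhds_iff.1 hFA
  refine ⟨c * ‖P‖₊, ?_⟩
  have hfst_P : Tendsto (fun p : E × G => (p.1, P p.2)) (𝓝 (x, F x)) (𝓝 (x, P (F x))) :=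
    Continuous.tendsto (by fun_prop) _
  have hPc : ∀ᶠ p in 𝓝 (x, F x), ∃ q, P (F q) = P p.2 ∧
      ‖q - p.1‖ ≤ c * ‖P (F p.1) - P p.2‖ :=
    hfst_P.eventually hc
  filter_upwards [hPc, eventually_dist_add_mul_norm_lt hF.continuousAt (c * ‖P‖₊ : ℝ≥0) hρ,
    continuousAt_snd.eventually (Metric.ball_mem_nhds (F x) hρ)] with p ⟨q, hPq, hq⟩ hp hp₂ hpA
  have hqp : ‖q - p.1‖ ≤ (c * ‖P‖₊ : ℝ≥0) * ‖F p.1 - p.2‖ := by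
    calc ‖q - p.1‖ ≤ c * ‖P (F p.1 - p.2)‖ := by rwa [map_sub]
      _ ≤ c * (‖P‖ * ‖F p.1 - p.2‖) := by gcongr; exact P.le_opNorm _
      _ = (c * ‖P‖₊ : ℝ≥0) * ‖F p.1 - p.2‖ := by push_cast; rw [mul_assoc]
  have hqx : dist q x < ρ := by
    rw [← dist_eq_norm] at hqp
    exact (dist_triangle q p.1 x).trans_lt (by linarith)
  exact ⟨q, hball (y := (q, p.2)) (max_lt hqx hp₂) hpA hPq, hqp⟩

end MetricSubregularity

section ChainRule

variable {n m : ℕ} {F : EuclideanSpace ℝ (Fin n) → EuclideanSpace ℝ (Fin m)}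
  {A : Set (EuclideanSpace ℝ (Fin m))} {x d h : EuclideanSpace ℝ (Fin n)}

theorem fderiv_mem_tangentCone (hF : DifferentiableAt ℝ F x) (hd : d ∈ tangentCone (F ⁻¹' A) x) :
    fderiv ℝ F x d ∈ tangentCone A (F x) := by
  obtain ⟨hx, t, v, ht, hv, hA⟩ := hd
  refine ⟨hx, t, fun k => (t k)⁻¹ • (F (x + t k • v k) - F x), ht, ?_, fun k => ?_⟩
  · exact (hF.hasFDerivAt.hasFDerivWithinAt (s := Set.univ)).lim (by simpa using ht.2.smul hv)
      (.of_forall fun _ => Set.mem_univ _)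
      (hv.congr fun k => (inv_smul_smul₀ (ht.1 k).ne' _).symm)
  · rw [smul_inv_smul₀ (ht.1 k).ne', add_sub_cancel]
    exact hA k

theorem fderiv_add_secondDeriv_mem_outerTangentSet₂ (hF : ContDiffAt ℝ 2 F x)
    (hh : h ∈ outerTangentSet₂ (F ⁻¹' A) x d) :
    fderiv ℝ F x h + secondDeriv F x d d ∈ outerTangentSet₂ A (F x) (fderiv ℝ F x d) := by
  obtain ⟨hd, t, v, ht, hv, hA⟩ := hh
  refine ⟨fderiv_mem_tangentCone (hF.differentiableAt (by norm_num)) hd, t, _, ht,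
    tendsto_secondOrderQuotient_comp hF d ht hv, fun k => ?_⟩
  rw [parabola_secondOrderQuotient (ht.1 k).ne']
  exact hA k

theorem MetricallySubregularAt.mem_innerTangentSet₂ (hA : MetricallySubregularAt F A x)
    (hF : ContDiffAt ℝ 2 F x) (hd : d ∈ tangentCone (F ⁻¹' A) x)
    (hh : fderiv ℝ F x h + secondDeriv F x d d ∈ innerTangentSet₂ A (F x) (fderiv ℝ F x d)) :
    h ∈ innerTangentSet₂ (F ⁻¹' A) x d := by
  refine mem_innerTangentSet₂_of_eventually hd fun t ht => ?_
  obtain ⟨w, hw, hwA⟩ := hh.2 t ht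
  obtain ⟨c, hc⟩ := hA
  set p : ℕ → EuclideanSpace ℝ (Fin n) := fun k => x + t k • d + ((1 / 2 : ℝ) * t k ^ 2) • h
  set y : ℕ → EuclideanSpace ℝ (Fin m) :=
    fun k => F x + t k • fderiv ℝ F x d + ((1 / 2 : ℝ) * t k ^ 2) • w k
  have hpy : Tendsto (fun k => (p k, y k)) atTop (𝓝 (x, F x)) :=
    (ht.tendsto_parabola x d tendsto_const_nhds).prodMk_nhds (ht.tendsto_parabola _ _ hw)
  obtain ⟨q, hq⟩ := ((hpy.eventually hc).mono fun k hk => hk (hwA k)).choice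
  have hexpansion : Tendsto (fun k => secondOrderQuotient (F x) (fderiv ℝ F x d) (t k) (F (p k)))
      atTop (𝓝 (fderiv ℝ F x h + secondDeriv F x d d)) :=
    tendsto_secondOrderQuotient_comp hF d ht tendsto_const_nhds
  have hdefect : Tendsto (fun k => c * ‖secondOrderQuotient (F x) (fderiv ℝ F x d) (t k) (F (p k))
      - w k‖) atTop (𝓝 0) := by
    simpa only [sub_self, norm_zero, mul_zero] using ((hexpansion.sub hw).norm).const_mul (c : ℝ)
  refine ⟨fun k => secondOrderQuotient x d (t k) (q k), ?_, hq.mono fun k hk => ?_⟩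
  · refine tendsto_iff_norm_sub_tendsto_zero.2 (squeeze_zero' (.of_forall fun _ => norm_nonneg _)
      (hq.mono fun k hk => ?_) hdefect)
    have ht₀ := (ht.1 k).ne'
    calc ‖secondOrderQuotient x d (t k) (q k) - h‖
        = ‖(2 / t k ^ 2 : ℝ)‖ * ‖q k - p k‖ := by
          rw [← norm_smul, ← secondOrderQuotient_sub x d, secondOrderQuotient_parabola ht₀]
      _ ≤ ‖(2 / t k ^ 2 : ℝ)‖ * (c * ‖F (p k) - y k‖) := by gcongr; exact hk.2
      _ = c * ‖secondOrderQuotient (F x) (fderiv ℝ F x d) (t k) (F (p k)) - w k‖ := by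
          rw [mul_left_comm, ← norm_smul, ← secondOrderQuotient_sub (F x) (fderiv ℝ F x d),
            secondOrderQuotient_parabola ht₀]
  · rw [parabola_secondOrderQuotient (ht.1 k).ne']
    exact hk.1

end ChainRule

section LICQ

theorem range_orthogonalProjectionOnto_comp_eq_top {E G : Type*} [NormedAddCommGroup E]
    [InnerProductSpace ℝ E] [CompleteSpace E] [NormedAddCommGroup G] [InnerProductSpace ℝ G]
    [CompleteSpace G] (A : E →L[ℝ] G) (S : Submodule ℝ G) [FiniteDimensional ℝ S]
    (hS : ∀ l ∈ S, ContinuousLinearMap.adjoint A l = 0 → l = 0) :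
    (S.orthogonalProjectionOnto ∘L A).range = ⊤ := by
  rw [← Submodule.orthogonal_eq_bot_iff, ContinuousLinearMap.orthogonal_range,
    ContinuousLinearMap.adjoint_comp, Submodule.adjoint_orthogonalProjectionOnto,
    LinearMap.ker_eq_bot']
  exact fun l hl => Subtype.ext (hS l l.2 hl)

variable {n m r : ℕ} {F : EuclideanSpace ℝ (Fin n) → EuclideanSpace ℝ (Fin m)}
  {D : Fin r → Set (EuclideanSpace ℝ (Fin m))} {x : EuclideanSpace ℝ (Fin n)}

theorem LICQ.range_eq_top (hLICQ : LICQ F D x) :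
    ((normalSpan D (F x)).orthogonalProjectionOnto ∘L fderiv ℝ F x).range = ⊤ :=
  range_orthogonalProjectionOnto_comp_eq_top _ _ fun l hl hl₀ => hLICQ l hl₀ hl

theorem LICQ.metricallySubregularAt (hLICQ : LICQ F D x) (hF : HasStrictFDerivAt F (fderiv ℝ F x) x)
    (hD : ∀ i, IsPolyhedral (D i)) : MetricallySubregularAt F (disjunctiveSet D) x := by
  refine metricallySubregularAt_of_range_comp_eq_top hF _ hLICQ.range_eq_top ?_
  filter_upwards [eventually_mem_disjunctiveSet_of_sub_mem_orthogonal hD (F x)] with p hp hp₁ hP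
  exact hp hp₁ (Submodule.orthogonalProjectionOnto_eq_zero_iff.1 (by rw [map_sub, hP, sub_self]))

theorem LICQ.exists_fderiv_add_mem_orthogonal (hLICQ : LICQ F D x) (b : EuclideanSpace ℝ (Fin m)) :
    ∃ h, fderiv ℝ F x h + b ∈ (normalSpan D (F x))ᗮ := by
  obtain ⟨h, hh⟩ := LinearMap.range_eq_top.1 hLICQ.range_eq_top
    (-(normalSpan D (F x)).orthogonalProjectionOnto b)
  refine ⟨h, Submodule.orthogonalProjectionOnto_eq_zero_iff.1 ?_⟩
  rw [map_add]
  exact eq_neg_iff_add_eq_zero.1 hh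

end LICQ

end MPDC

open MPDC in
theorem mainTheorem6_general {n m r : ℕ}
    (F : EuclideanSpace ℝ (Fin n) → EuclideanSpace ℝ (Fin m))
    (D : Fin r → Set (EuclideanSpace ℝ (Fin m))) (hD : ∀ i, IsPolyhedral (D i))
    (x : EuclideanSpace ℝ (Fin n)) (hF : ContDiffAt ℝ 2 F x) (hLICQ : LICQ F D x)
    (d : EuclideanSpace ℝ (Fin n)) (hd : d ∈ tangentCone (feasibleSet F D) x) :
    outerTangentSet₂ (feasibleSet F D) x d =
        {h | fderiv ℝ F x h + secondDeriv F x d d ∈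
          tangentCone (tangentCone (disjunctiveSet D) (F x)) (fderiv ℝ F x d)} ∧
      (outerTangentSet₂ (feasibleSet F D) x d).Nonempty ∧
      ParabolicallyDerivableAt (feasibleSet F D) x d := by
  have hconic := locallyConicAt_disjunctiveSet hD (F x)
  have hconic' := locallyConicAt_tangentCone_disjunctiveSet hD (F x) (fderiv ℝ F x d)
  have hreg := hLICQ.metricallySubregularAt (hF.hasStrictFDerivAt (by norm_num)) hD
  have hinner_outer := innerTangentSet₂_subset_outerTangentSet₂ (feasibleSet F D) x d
  have hnecessary : ∀ h ∈ outerTangentSet₂ (feasibleSet F D) x d,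
      fderiv ℝ F x h + secondDeriv F x d d ∈
        tangentCone (tangentCone (disjunctiveSet D) (F x)) (fderiv ℝ F x d) := fun h hh =>
    hconic.outerTangentSet₂_subset (fderiv_add_secondDeriv_mem_outerTangentSet₂ hF hh)
  have hsufficient : ∀ h, fderiv ℝ F x h + secondDeriv F x d d ∈
      tangentCone (tangentCone (disjunctiveSet D) (F x)) (fderiv ℝ F x d) →
        h ∈ innerTangentSet₂ (feasibleSet F D) x d := fun h hh =>
    hreg.mem_innerTangentSet₂ hF hd (hconic.tangentCone_subset_innerTangentSet₂ hconic' hh)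
  obtain ⟨h, hh⟩ := hLICQ.exists_fderiv_add_mem_orthogonal (secondDeriv F x d d)
  have hAd := fderiv_mem_tangentCone (hF.differentiableAt (by norm_num)) hd
  have hhT := orthogonal_normalSpan_subset_tangentCone_tangentCone hD hAd hh
  exact ⟨Set.Subset.antisymm hnecessary fun h hh => hinner_outer (hsufficient h hh),
    ⟨h, hinner_outer (hsufficient h hhT)⟩,
    hinner_outer.antisymm fun h hh => hsufficient h (hnecessary h hh)⟩

theorem mainTheorem6 {n m r : ℕ}
    (F : EuclideanSpace ℝ (Fin n) → EuclideanSpace ℝ (Fin m)) (hF : ContDiff ℝ 2 F)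
    (D : Fin r → Set (EuclideanSpace ℝ (Fin m))) (hD : ∀ i, MPDC.IsPolyhedral (D i))
    (x : EuclideanSpace ℝ (Fin n)) (hx : x ∈ MPDC.feasibleSet F D)
    (hLICQ : MPDC.LICQ F D x)
    (d : EuclideanSpace ℝ (Fin n)) (hd : d ∈ MPDC.tangentCone (MPDC.feasibleSet F D) x) :
    MPDC.outerTangentSet₂ (MPDC.feasibleSet F D) x d =
        {h | fderiv ℝ F x h + MPDC.secondDeriv F x d d ∈
          MPDC.tangentCone (MPDC.tangentCone (MPDC.disjunctiveSet D) (F x)) (fderiv ℝ F x d)} ∧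
      (MPDC.outerTangentSet₂ (MPDC.feasibleSet F D) x d).Nonempty ∧
      MPDC.ParabolicallyDerivableAt (MPDC.feasibleSet F D) x d :=
  mainTheorem6_general F D hD x hF.contDiffAt hLICQ d hd
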